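/- **Definitions.** For a topological space $M$ and an integer $n\ge 0$, $\dim M\le n$ means that every finite open cover of $M$ has a finite open refinement in which any $n+2$ members have empty intersection; $M$ is called $0$-dimensional if $\dim M\le 0$ (so the empty space is allowed). An $F_\sigma$-set is a countable union of closed sets, and a perfect map is a continuous closed map with compact fibers. Let $\mathrm S$ be a topological (homeomorphism-invariant) property of metrizable spaces, and write $M\in\mathrm S$ if $M$ has this property. Consider the conditions: (i) if $M\in\mathrm S$ is metrizable and $H\subset M$ is closed, then $H\in\mathrm S$; (ii) if $M$ is metrizable and $(H_i)_{i\ge 1}$ is a sequence of closed subsets of $M$ with all $H_i\in\mathrm S$, then $\bigcup_{i\ge 1} H_i\in\mathrm S$; (iii) a metrizable space $M$ belongs to $\mathrm S$ whenever there is a continuous closed surjection $p\colon M\to N$ onto a $0$-dimensional metrizable space $N$ with $p^{-1}(z)\in\mathrm S$ for all $z\in N$; (iv) every discrete union (topological sum) of metrizable spaces from $\mathrm S$ belongs to $\mathrm S$. $\mathrm S$ is called an *$\mathrm S$-property* if (i)–(iv) hold. **Theorem 1.1.** Let $f\colon X\to Y$ be a continuous closed surjection between metrizable spaces such that $f^{-1}(y)\in\mathrm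 S$ for every $y\in Y$. If $\mathrm S$ is an $\mathrm S$-property, then there exists an $F_\sigma$-set $A\subset X$ such that $A\in\mathrm S$ and $\dim\bigl(f^{-1}(y)\setminus A\bigr)\le 0$ for every $y\in Y$. Moreover, if $f$ is perfect, the same conclusion holds provided $\mathrm S$ satisfies conditions (i)–(iii). -/

import Mathlib

universe u v

/-- `CoveringDimLE M n`: the covering dimension of `M` is at most `n`, i.e. every finite open cover
of `M` has a finite open refinement of order at most `n` (any `n + 2` members have empty
intersection). The empty space satisfies this for every `n`; in particular
`CoveringDimLE M 0` reads "`M` is zero-dimensional", the empty space included. -/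
def CoveringDimLE (M : Type*) [TopologicalSpace M] (n : ℕ) : Prop :=
  ∀ (k : ℕ) (U : Fin k → Set M), (∀ i, IsOpen (U i)) → (⋃ i, U i) = Set.univ →
    ∃ (l : ℕ) (V : Fin l → Set M), (∀ j, IsOpen (V j)) ∧ (⋃ j, V j) = Set.univ ∧
      (∀ j, ∃ i, V j ⊆ U i) ∧
      ∀ s : Finset (Fin l), s.card = n + 2 → (⋂ j ∈ s, V j) = ∅

/-- `A` is an `F_σ`-subset: a countable union of closed sets. -/
def IsFSigmaSet {X : Type*} [TopologicalSpace X] (A : Set X) : Prop :=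
  ∃ H : ℕ → Set X, (∀ n, IsClosed (H n)) ∧ A = ⋃ n, H n

/-- A topological property `S` of metrizable spaces (only its values at metrizable spaces matter)
satisfying the first three conditions in the definition of an `S`-property. -/
structure IsWeakSProperty (S : (M : Type u) → [TopologicalSpace M] → Prop) : Prop where
  /-- `S` is a topological property. -/
  homeo : ∀ (M N : Type u) [TopologicalSpace M] [TopologicalSpace N]
    [TopologicalSpace.MetrizableSpace M] [TopologicalSpace.MetrizableSpace N],
    M ≃ₜ N → S M → S N
  /-- (i) `S` is hereditary with respect to closed subsets. -/
  closed_subset : ∀ (M : Type u) [TopologicalSpace M] [TopologicalSpace.MetrizableSpace M]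
    (H : Set M), IsClosed H → S M → S H
  /-- (ii) The union of a sequence of closed `S`-subsets of a metrizable space is in `S`. -/
  countable_union : ∀ (M : Type u) [TopologicalSpace M] [TopologicalSpace.MetrizableSpace M]
    (H : ℕ → Set M), (∀ i, IsClosed (H i)) → (∀ i, S (H i)) → S (⋃ i, H i : Set M)
  /-- (iii) A metrizable space is in `S` if it admits a closed (continuous) surjection with fibers
  in `S` onto a zero-dimensional metrizable space. -/
  of_closed_map : ∀ (M N : Type u) [TopologicalSpace M] [TopologicalSpace N]
    [TopologicalSpace.MetrizableSpace M] [TopologicalSpace.MetrizableSpace N] (f : M → N),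
    Continuous f → IsClosedMap f → Function.Surjective f → CoveringDimLE N 0 →
    (∀ y, S (f ⁻¹' {y})) → S M

/-- `S` is an `S`-property: conditions (i)-(iii), and (iv) discrete unions (topological sums) of
`S`-spaces are `S`-spaces. -/
structure IsSProperty (S : (M : Type u) → [TopologicalSpace M] → Prop) : Prop
    extends IsWeakSProperty S where
  discrete_union : ∀ (ι : Type u) (M : ι → Type u) [∀ i, TopologicalSpace (M i)]
    [∀ i, TopologicalSpace.MetrizableSpace (M i)], (∀ i, S (M i)) → S (Σ i, M i)

open Set Filter Topology


/-! Perfect case: there are countably many continuous `g j` on X such that any set missing a single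
level t ∈ (0,1) of all of them is zero-dimensional (`exists_continuous_levels`). So from each fibre
it suffices to remove the sets g_j = t for one t, which may vary with the fibre. Y is the perfect
image of a zero-dimensional closed D ⊆ Y × (ℕ → ℕ), and ℕ → ℕ injects continuously into (0,1) by ι;
over y the levels ι a with (y, a) ∈ D are removed. The pairs (x, a) with (f x, a) ∈ D and g_j x = ι
a map perfectly into D, with fibres embedding as closed subsets of fibres of f, so (iii) puts this
space in S; injectivity of ι makes it a closed subset of X.

General case: f is perfect off the union O of the fibre interiors (Vainstein's lemma), and O is a
countable union of closed sets, each with discrete image under f, so (iii) applies to these too. -/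

/-! ### Criteria for zero-dimensionality -/

theorem CoveringDimLE.of_homeomorph {M N : Type*} [TopologicalSpace M] [TopologicalSpace N]
    {n : ℕ} (h : CoveringDimLE M n) (e : M ≃ₜ N) : CoveringDimLE N n := by
  intro k U hU hUc
  obtain ⟨l, V, hV, hVc, hVU, hVd⟩ := h k (fun i => e ⁻¹' U i)
    (fun i => (hU i).preimage e.continuous) (by rw [← preimage_iUnion, hUc, preimage_univ])
  refine ⟨l, fun j => e.symm ⁻¹' V j, fun j => (hV j).preimage e.symm.continuous, ?_, ?_, ?_⟩
  · rw [← preimage_iUnion, hVc, preimage_univ]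
  · intro j
    obtain ⟨i, hi⟩ := hVU j
    exact ⟨i, fun y hy => by simpa using hi hy⟩
  · intro s hs
    rw [← preimage_iInter₂, hVd s hs, preimage_empty]

/-- A space whose topology is generated by countably many locally constant functions is
zero-dimensional. -/
theorem coveringDimLE_zero_of_isLocallyConstant {M : Type*} [TopologicalSpace M]
    {α : ℕ → Type*} (e : ∀ n, M → α n) (he : ∀ n, IsLocallyConstant (e n))
    (hb : ∀ x, ∀ U ∈ 𝓝 x, ∃ n, ∀ y, (∀ k ≤ n, e k y = e k x) → y ∈ U) :
    CoveringDimLE M 0 := by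
  classical
  intro k U hU hUc
  let C : ℕ → M → Set M := fun n x => {y | ∀ k ≤ n, e k y = e k x}
  have hCo : ∀ n x, IsOpen (C n x) := by
    intro n x
    have : C n x = ⋂ k ∈ Iic n, {y | e k y = e k x} := by ext y; simp [C]
    rw [this]
    exact (finite_Iic n).isOpen_biInter fun k _ => (he k).isOpen_fiber _
  have hCmem : ∀ n x, x ∈ C n x := fun n x k _ => rfl
  have hCeq : ∀ n m x y, m ≤ n → y ∈ C n x → C m y = C m x := by
    intro n m x y hmn hy
    ext z
    exact forall₂_congr fun k hk => by rw [hy k (hk.trans hmn)]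
  have hex : ∀ x, ∃ n, ∃ i, C n x ⊆ U i := by
    intro x
    obtain ⟨i, hi⟩ := mem_iUnion.1 (hUc.ge (mem_univ x))
    obtain ⟨n, hn⟩ := hb x (U i) ((hU i).mem_nhds hi)
    exact ⟨n, i, hn⟩
  -- First level at which the cylinder of `x` fits in some `U i`. `N` is constant on that cylinder,
  -- and `J` depends only on the cylinder as a set, so `I` is locally constant and its fibres are
  -- disjoint and open.
  let N : M → ℕ := fun x => Nat.find (hex x)
  have hN : ∀ x, ∃ i, C (N x) x ⊆ U i := fun x => Nat.find_spec (hex x)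
  choose J hJ using fun c : {c : Set M // ∃ i, c ⊆ U i} => c.2
  let I : M → Fin k := fun x => J ⟨C (N x) x, hN x⟩
  have hNeq : ∀ x, ∀ y ∈ C (N x) x, N y = N x := by
    intro x y hy
    refine (Nat.find_eq_iff _).2 ⟨?_, fun m hm => ?_⟩
    · rw [hCeq _ _ x y le_rfl hy]
      exact hN x
    · rw [hCeq _ _ x y hm.le hy]
      exact Nat.find_min (hex x) hm
  have hI : ∀ x, ∀ y ∈ C (N x) x, I y = I x := by
    intro x y hy
    have : C (N y) y = C (N x) x := by rw [hNeq x y hy, hCeq _ _ x y le_rfl hy]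
    simp only [I, this]
  refine ⟨k, fun i => {x | I x = i}, fun i => ?_, ?_, fun i => ⟨i, ?_⟩, fun s hs => ?_⟩
  · refine isOpen_iff_mem_nhds.2 fun x hx => ?_
    exact mem_of_superset ((hCo (N x) x).mem_nhds (hCmem _ _)) fun y hy => (hI x y hy).trans hx
  · exact eq_univ_of_forall fun x => mem_iUnion.2 ⟨I x, rfl⟩
  · rintro x rfl
    exact hJ ⟨C (N x) x, hN x⟩ (hCmem _ _)
  · obtain ⟨i, hi, j, hj, hij⟩ := Finset.one_lt_card.1 (show 1 < s.card by omega)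
    refine eq_empty_of_forall_notMem fun x hx => hij ?_
    rw [mem_iInter₂] at hx
    exact (hx i hi).symm.trans (hx j hj)

theorem coveringDimLE_zero_of_discreteTopology (M : Type*) [TopologicalSpace M]
    [DiscreteTopology M] : CoveringDimLE M 0 :=
  coveringDimLE_zero_of_isLocallyConstant (fun _ => (id : M → M))
    (fun _ => IsLocallyConstant.of_discrete _)
    (fun x U hU => ⟨0, fun y hy => by
      rw [show y = x from hy 0 le_rfl]; exact mem_of_mem_nhds hU⟩)

/-! ### Covers of metric spaces by small disjoint families -/

/-- Stone: a metric space is covered by countably many disjoint families of small open sets. -/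
theorem exists_pairwise_disjoint_isOpen_subset_ball (M : Type*) [MetricSpace M] {ε : ℝ}
    (hε : 0 < ε) :
    ∃ V : ℕ → M → Set M, (∀ m s, IsOpen (V m s)) ∧
      (∀ m, Pairwise fun s t => Disjoint (V m s) (V m t)) ∧
      (∀ m s, V m s ⊆ Metric.ball s ε) ∧ ⋃ m, ⋃ s, V m s = univ := by
  obtain ⟨_, _⟩ := exists_wellFoundedLT M
  -- `s` is the least centre whose ball contains `x`, with margin 1/(m+1). Distinct `C m s` are thus
  -- 1/(m+1) apart, and half-width thickenings are disjoint.
  let C : ℕ → M → Set M := fun m s =>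
    {x | Metric.ball x (1 / (m + 1)) ⊆ Metric.ball s ε ∧ ∀ t < s, x ∉ Metric.ball t ε}
  have hsep : ∀ m s t, s < t → ∀ x ∈ C m s, ∀ y ∈ C m t, (1 : ℝ) / (m + 1) ≤ dist y x := by
    intro m s t hst x hx y hy
    by_contra! h
    exact hy.2 s hst (hx.1 h)
  have hpos : ∀ m : ℕ, (0 : ℝ) < 1 / (m + 1) := fun m => Nat.one_div_pos_of_nat
  refine ⟨fun m s => Metric.thickening (1 / (m + 1) / 2) (C m s),
    fun m s => Metric.isOpen_thickening, ?_, ?_, ?_⟩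
  · have key : ∀ (m : ℕ) (s t : M), s < t → Disjoint (Metric.thickening (1 / ((m : ℝ) + 1) / 2) (C m s))
        (Metric.thickening (1 / ((m : ℝ) + 1) / 2) (C m t)) := by
      intro m s t hst
      refine disjoint_left.2 fun z hzs hzt => ?_
      obtain ⟨x, hx, hxz⟩ := Metric.mem_thickening_iff.1 hzs
      obtain ⟨y, hy, hyz⟩ := Metric.mem_thickening_iff.1 hzt
      have := hsep m s t hst x hx y hy
      have := dist_triangle_left y x z
      linarith
    intro m s t hst
    rcases lt_or_gt_of_ne hst with h | h
    · exact key m s t h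
    · exact (key m t s h).symm
  · intro m s z hz
    obtain ⟨x, hx, hxz⟩ := Metric.mem_thickening_iff.1 hz
    refine hx.1 (Metric.mem_ball.2 (hxz.trans ?_))
    linarith [hpos m]
  · refine eq_univ_of_forall fun x => ?_
    have hne : {s | x ∈ Metric.ball s ε}.Nonempty := ⟨x, Metric.mem_ball_self hε⟩
    let s := wellFounded_lt.min {s | x ∈ Metric.ball s ε} hne
    have hs : x ∈ Metric.ball s ε := wellFounded_lt.min_mem _ hne
    obtain ⟨δ, hδ, hδs⟩ := Metric.isOpen_iff.1 Metric.isOpen_ball x hs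
    obtain ⟨m, hm⟩ := exists_nat_one_div_lt hδ
    refine mem_iUnion₂.2 ⟨m, s, Metric.self_subset_thickening (half_pos (hpos m)) _
      ⟨(Metric.ball_subset_ball hm.le).trans hδs, fun t ht hxt => ?_⟩⟩
    exact wellFounded_lt.not_lt_min {s | x ∈ Metric.ball s ε} hxt ht

/-- A countable locally finite closed cover, each member of which is covered by a disjoint family
of small open sets. -/
theorem exists_locallyFinite_isClosed_cover (M : Type*) [MetricSpace M] {ε : ℝ} (hε : 0 < ε) :
    ∃ (F : ℕ → Set M) (V : ℕ → M → Set M), (∀ m, IsClosed (F m)) ∧ LocallyFinite F ∧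
      ⋃ m, F m = univ ∧ (∀ m, F m ⊆ ⋃ s, V m s) ∧ (∀ m s, IsOpen (V m s)) ∧
      (∀ m, Pairwise fun s t => Disjoint (V m s) (V m t)) ∧
      (∀ m s, V m s ⊆ Metric.ball s ε) := by
  obtain ⟨V, hVo, hVd, hVb, hVc⟩ := exists_pairwise_disjoint_isOpen_subset_ball M hε
  obtain ⟨W, hWo, hWc, hWf, hWV⟩ := precise_refinement (fun m => ⋃ s, V m s)
    (fun m => isOpen_iUnion (hVo m)) hVc
  obtain ⟨F, hFc, hFcl, hFW⟩ := exists_iUnion_eq_closed_subset hWo hWf.point_finite hWc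
  exact ⟨F, V, hFcl, hWf.subset hFW, hFc, fun m => (hFW m).trans (hWV m), hVo, hVd, hVb⟩

/-- The indicator of the graph of `a` is a binary sequence, hence a point of the Cantor set; an
affine map then moves [0,1] into [1/3, 2/3]. -/
theorem exists_continuous_injective_baire_real :
    ∃ ι : (ℕ → ℕ) → ℝ, Continuous ι ∧ Function.Injective ι ∧ ∀ a, ι a ∈ Ioo (0 : ℝ) 1 := by
  let b : (ℕ → ℕ) → ℕ → Bool := fun a n => decide (a n.unpair.1 = n.unpair.2)
  have hb : Continuous b := continuous_pi fun n =>
    (continuous_of_discreteTopology (f := fun i : ℕ => decide (i = n.unpair.2))).comp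
      (continuous_apply n.unpair.1)
  have hbi : Function.Injective b := by
    intro a a' h
    ext n
    have := congrFun h (Nat.pair n (a n))
    simp only [b, Nat.unpair_pair, decide_true] at this
    exact (of_decide_eq_true this.symm).symm
  let c : (ℕ → Bool) ≃ₜ cantorSet := cantorSetHomeomorphNatToBool.symm
  refine ⟨fun a => (1 + (c (b a) : ℝ)) / 3, ?_, fun a a' h => ?_, fun a => ?_⟩
  · fun_prop
  · refine hbi (c.injective (Subtype.ext ?_))
    simp only at h
    linarith
  · have := cantorSet_subset_unitInterval (c (b a)).2
    constructor <;> linarith [this.1, this.2]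

/-! ### Transfer of S along maps -/

variable {S : (M : Type u) → [TopologicalSpace M] → Prop}

theorem IsWeakSProperty.of_isClosedEmbedding (hS : IsWeakSProperty S) {A B : Type u}
    [TopologicalSpace A] [TopologicalSpace B] [TopologicalSpace.MetrizableSpace A]
    [TopologicalSpace.MetrizableSpace B] {i : A → B} (hi : IsClosedEmbedding i) (hB : S B) : S A :=
  hS.homeo (range i) A hi.isEmbedding.toHomeomorph.symm
    (hS.closed_subset B _ hi.isClosed_range hB)

/-- Condition (iii) wants a target in `Type u`; the range of `q`, an image of `E`, is small and is
replaced by its `Shrink`. -/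
theorem IsWeakSProperty.of_isClosedMap (hS : IsWeakSProperty S) {E : Type u} {N : Type v}
    [TopologicalSpace E] [TopologicalSpace N] [TopologicalSpace.MetrizableSpace E]
    [TopologicalSpace.MetrizableSpace N] {q : E → N} (hq : Continuous q) (hqc : IsClosedMap q)
    (hdim : CoveringDimLE (range q) 0) (hfib : ∀ x, S (q ⁻¹' {q x})) : S E := by
  let h : range q ≃ₜ Shrink.{u} (range q) := Shrink.homeomorph _
  have := h.symm.isEmbedding.metrizableSpace
  have hr : IsClosedMap (rangeFactorization q) := fun C hC => by
    refine ⟨(q '' C)ᶜ, (hqc C hC).isOpen_compl, ?_⟩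
    ext ⟨_, x, rfl⟩
    simp [rangeFactorization, Subtype.ext_iff]
  refine hS.of_closed_map E (Shrink.{u} (range q)) (h ∘ rangeFactorization q)
    (h.continuous.comp hq.rangeFactorization) (h.isClosedMap.comp hr)
    (h.surjective.comp rangeFactorization_surjective) (hdim.of_homeomorph h) fun y => ?_
  obtain ⟨x, rfl⟩ := (h.surjective.comp rangeFactorization_surjective) y
  have hset : (h ∘ rangeFactorization q) ⁻¹' {(h ∘ rangeFactorization q) x} = q ⁻¹' {q x} := by
    ext x'
    simp [rangeFactorization, Subtype.ext_iff]
  rw [hset]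
  exact hfib x

/-! ### Zero-dimensional covers and level functions -/

/-- Every metrizable space `Y` is the perfect image of a closed zero-dimensional subspace of
`Y × (ℕ → ℕ)`. -/
theorem exists_zeroDimensional_cover (Y : Type*) [TopologicalSpace Y]
    [TopologicalSpace.MetrizableSpace Y] :
    ∃ D : Set (Y × (ℕ → ℕ)), IsClosed D ∧ (∀ D' ⊆ D, CoveringDimLE D' 0) ∧
      (∀ y, ∃ a, (y, a) ∈ D) ∧ IsProperMap fun p : D => p.1.1 := by
  classical
  let _ := TopologicalSpace.metrizableSpaceMetric Y
  have hpos : ∀ n : ℕ, (0 : ℝ) < 1 / (n + 1) := fun n => Nat.one_div_pos_of_nat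
  choose F V hFcl hFlf hFc hFV hVo hVd hVb using
    fun n : ℕ => exists_locallyFinite_isClosed_cover Y (hpos n)
  have happ : ∀ n, Continuous fun p : Y × (ℕ → ℕ) => p.2 n := fun n => by fun_prop
  -- The sequence is an address of the point: it selects a closed set containing it at each scale.
  let D : Set (Y × (ℕ → ℕ)) := {p | ∀ n, p.1 ∈ F n (p.2 n)}
  have hDcl : IsClosed D := by
    simp only [D]
    rw [ofPred_forall]
    refine isClosed_iInter fun n => ⟨isOpen_iff_mem_nhds.2 fun p hp => ?_⟩
    filter_upwards [(happ n).continuousAt (isOpen_discrete {p.2 n} |>.mem_nhds rfl),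
      continuous_fst.continuousAt ((hFcl n (p.2 n)).isOpen_compl.mem_nhds hp)] with q hq hq'
    simp only [mem_preimage, mem_singleton_iff] at hq
    simpa [hq] using hq'
  refine ⟨D, hDcl, fun D' hD' => ?_, fun y => ?_, ?_⟩
  · have hs : ∀ n (p : D'), ∃ s, p.1.1 ∈ V n (p.1.2 n) s := fun n p =>
      mem_iUnion.1 (hFV _ _ (hD' p.2 n))
    choose s hs using hs
    -- The address entry and the disjoint open piece holding the point are locally constant; pieces
    -- of radius 1/(n+1) control the `Y` coordinate.
    refine coveringDimLE_zero_of_isLocallyConstant (fun n p => (p.1.2 n, s n p)) (fun n => ?_) ?_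
    · refine (IsLocallyConstant.iff_eventually_eq _).2 fun p => ?_
      have h1 : Continuous fun p : D' => p.1.2 n := by fun_prop
      have h2 : Continuous fun p : D' => p.1.1 := by fun_prop
      filter_upwards [h1.continuousAt (isOpen_discrete {p.1.2 n} |>.mem_nhds rfl),
        h2.continuousAt ((hVo n (p.1.2 n) (s n p)).mem_nhds (hs n p))] with q hq hq'
      simp only [mem_preimage, mem_singleton_iff] at hq hq'
      refine Prod.ext hq (by_contra fun hne => ?_)
      have h3 := hs n q
      rw [hq] at h3
      exact disjoint_left.1 (hVd n (p.1.2 n) hne) h3 hq'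
    · intro p U hU
      obtain ⟨W, hW, hWU⟩ := mem_nhds_subtype _ _ _ |>.1 hU
      obtain ⟨A, hA, B, hB, hAB⟩ := mem_nhds_prod_iff.1 hW
      obtain ⟨δ, hδ, hδA⟩ := Metric.mem_nhds_iff.1 hA
      obtain ⟨n₁, hn₁⟩ := exists_nat_one_div_lt (half_pos hδ)
      obtain ⟨n₂, hn₂⟩ : ∃ n₂ : ℕ, ∀ b : ℕ → ℕ, (∀ k ≤ n₂, b k = p.1.2 k) → b ∈ B := by
        rw [nhds_pi, Filter.mem_pi] at hB
        obtain ⟨I, hI, t, ht, htB⟩ := hB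
        obtain ⟨n₂, hn₂⟩ := hI.bddAbove
        refine ⟨n₂, fun b hb => htB fun i hi => ?_⟩
        rw [hb i (hn₂ hi)]
        exact mem_of_mem_nhds (ht i)
      refine ⟨max n₁ n₂, fun q hq => hWU (hAB ⟨hδA ?_, hn₂ _ fun k hk => ?_⟩)⟩
      · have h1 := Prod.ext_iff.1 (hq n₁ (le_max_left _ _))
        have h2 := hVb _ _ _ (hs n₁ q)
        have h3 := hVb _ _ _ (hs n₁ p)
        simp only at h1
        rw [h1.2, Metric.mem_ball] at h2
        rw [Metric.mem_ball] at h3 ⊢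
        have := dist_triangle_right q.1.1 p.1.1 (s n₁ p)
        linarith
      · exact (Prod.ext_iff.1 (hq k (hk.trans (le_max_right _ _)))).1
  · choose a ha using fun n => mem_iUnion.1 ((hFc n).ge (mem_univ y))
    exact ⟨a, ha⟩
  · refine isProperMap_iff_ultrafilter.2 ⟨by fun_prop, fun 𝒰 y hy => ?_⟩
    -- By local finiteness only finitely many indices occur near `y`, so the ultrafilter settles on
    -- one.
    have hlim : ∀ n, ∃ m, ∀ᶠ p : D in 𝒰, p.1.2 n = m := by
      intro n
      obtain ⟨W, hW, hWf⟩ := hFlf n y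
      have : ∀ᶠ p : D in 𝒰, ∃ m ∈ {m | (F n m ∩ W).Nonempty}, p.1.2 n = m := by
        filter_upwards [hy hW] with p hp
        exact ⟨_, ⟨p.1.1, p.2 n, hp⟩, rfl⟩
      obtain ⟨m, -, hm⟩ := (Ultrafilter.eventually_exists_mem_iff hWf).1 this
      exact ⟨m, hm⟩
    choose a ha using hlim
    have hlim : Tendsto (fun p : D => p.1) 𝒰
        (𝓝 (y, a)) := by
      refine hy.prodMk_nhds (tendsto_pi_nhds.2 fun n => ?_)
      exact tendsto_const_nhds.congr' ((ha n).mono fun p hp => hp.symm)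
    have hmem := hDcl.mem_of_tendsto hlim (Eventually.of_forall fun p => p.2)
    exact ⟨⟨(y, a), hmem⟩, rfl, tendsto_subtype_rng.2 hlim⟩

/-- Take Urysohn functions equal to 1 on `F n m` and 0 off the pieces `V n m s`. If K misses level
t, then {g > t} is clopen in K and splits into small disjoint open pieces. -/
theorem exists_continuous_levels (X : Type*) [TopologicalSpace X]
    [TopologicalSpace.MetrizableSpace X] :
    ∃ g : ℕ → X → ℝ, (∀ j, Continuous (g j)) ∧ ∀ (K : Set X) (t : ℝ), t ∈ Ioo (0 : ℝ) 1 →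
      (∀ j, ∀ x ∈ K, g j x ≠ t) → CoveringDimLE K 0 := by
  classical
  let _ := TopologicalSpace.metrizableSpaceMetric X
  have hpos : ∀ n : ℕ, (0 : ℝ) < 1 / (n + 1) := fun n => Nat.one_div_pos_of_nat
  choose F V hFcl _ hFc hFV hVo hVd hVb using
    fun n : ℕ => exists_locallyFinite_isClosed_cover X (hpos n)
  choose g hg0 hg1 hg using fun n m => exists_continuous_zero_one_of_isClosed
    (isOpen_iUnion (hVo n m)).isClosed_compl (hFcl n m)
    (disjoint_compl_left_iff_subset.2 (hFV n m))
  have hpiece : ∀ n m x, 0 < g n m x → ∃ s, x ∈ V n m s := by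
    intro n m x hx
    by_contra h
    have := hg0 n m (show x ∈ (⋃ s, V n m s)ᶜ by simpa using h)
    simp [this] at hx
  refine ⟨fun j => g j.unpair.1 j.unpair.2, fun j => (g _ _).continuous, fun K t ht hK => ?_⟩
  have hs : ∀ n m (x : K), ∃ o : Option X,
      (t < g n m x → ∃ s, o = some s ∧ x.1 ∈ V n m s) ∧ (g n m x < t → o = none) := by
    intro n m x
    by_cases h : t < g n m x
    · obtain ⟨s, hs⟩ := hpiece n m x (ht.1.trans h)
      exact ⟨some s, fun _ => ⟨s, rfl, hs⟩, fun h' => absurd h' h.not_gt⟩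
    · exact ⟨none, fun h' => absurd h' h, fun _ => rfl⟩
  choose o ho ho' using hs
  refine coveringDimLE_zero_of_isLocallyConstant (fun j x => o j.unpair.1 j.unpair.2 x)
    (fun j => ?_) fun x U hU => ?_
  · refine (IsLocallyConstant.iff_eventually_eq _).2 fun x => ?_
    have hgc : Continuous fun x : K => g j.unpair.1 j.unpair.2 x := by fun_prop
    rcases lt_or_gt_of_ne (hK j x x.2) with h | h
    · filter_upwards [hgc.continuousAt (isOpen_Iio.mem_nhds h)] with y hy
      rw [ho' _ _ _ h, ho' _ _ _ hy]
    · obtain ⟨s, hs, hxs⟩ := ho _ _ _ h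
      filter_upwards [hgc.continuousAt (isOpen_Ioi.mem_nhds h),
        continuous_subtype_val.continuousAt ((hVo _ _ _).mem_nhds hxs)] with y hy hy'
      obtain ⟨s', hs', hys⟩ := ho _ _ _ hy
      rw [hs, hs']
      by_contra hne
      exact disjoint_left.1 (hVd _ _ fun h => hne (congrArg some h)) hys hy'
  · obtain ⟨W, hW, hWU⟩ := mem_nhds_subtype _ _ _ |>.1 hU
    obtain ⟨δ, hδ, hδW⟩ := Metric.mem_nhds_iff.1 hW
    obtain ⟨n, hn⟩ := exists_nat_one_div_lt (half_pos hδ)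
    obtain ⟨m, hm⟩ := mem_iUnion.1 ((hFc n).ge (mem_univ x.1))
    refine ⟨Nat.pair n m, fun y hy => hWU (hδW ?_)⟩
    have hy := hy _ le_rfl
    simp only [Nat.unpair_pair] at hy
    obtain ⟨s, hs, hxs⟩ := ho n m x (by rw [hg1 n m hm]; exact ht.2)
    have hys : y.1 ∈ V n m s := by
      by_cases h : t < g n m y
      · obtain ⟨s', hs', hys⟩ := ho n m y h
        rw [hy, hs, Option.some_inj] at hs'
        rwa [hs']
      · have h1 := hK (Nat.pair n m) y y.2
        simp only [Nat.unpair_pair] at h1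
        rw [ho' n m y (lt_of_le_of_ne (not_lt.1 h) h1), hs] at hy
        exact absurd hy (by simp)
    have h2 := hVb _ _ _ hys
    have h3 := hVb _ _ _ hxs
    rw [Metric.mem_ball] at h2 h3 ⊢
    have := dist_triangle_right y.1 x.1 s
    linarith

/-! ### Perfect maps -/

/-- The perfect case, with the fibers over points outside the range of `f` allowed. -/
theorem IsWeakSProperty.exists_isClosed_of_isProperMap (hS : IsWeakSProperty S) {X : Type u}
    {Y : Type v} [TopologicalSpace X] [TopologicalSpace Y] [TopologicalSpace.MetrizableSpace X]
    [TopologicalSpace.MetrizableSpace Y] {f : X → Y} (hf : IsProperMap f)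
    (hfib : ∀ y, S (f ⁻¹' {y})) :
    ∃ Z : ℕ → Set X, (∀ j, IsClosed (Z j)) ∧ (∀ j, S (Z j)) ∧
      ∀ y, CoveringDimLE (f ⁻¹' {y} \ ⋃ j, Z j : Set X) 0 := by
  obtain ⟨D, hD, hdim, hDsurj, hDprop⟩ := exists_zeroDimensional_cover Y
  obtain ⟨ι, hι, hιi, hιI⟩ := exists_continuous_injective_baire_real
  obtain ⟨g, hg, hgdim⟩ := exists_continuous_levels X
  let E : ℕ → Set (X × (ℕ → ℕ)) := fun j => {p | (f p.1, p.2) ∈ D ∧ g j p.1 = ι p.2}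
  have hE : ∀ j, IsClosed (E j) := fun j =>
    (hD.preimage (hf.continuous.prodMap continuous_id)).inter
      (isClosed_eq ((hg j).comp continuous_fst) (hι.comp continuous_snd))
  have hemb : ∀ j, IsClosedEmbedding fun p : E j => p.1.1 := by
    intro j
    -- `g j x = ι a` recovers `a` from `x`; properness is inherited from that of D → Y.
    refine .of_continuous_injective_isClosedMap (by fun_prop) (fun p q hpq => ?_)
      (IsProperMap.isClosedMap (isProperMap_iff_ultrafilter.2 ⟨by fun_prop, fun 𝒰 x hx => ?_⟩))
    · refine Subtype.ext (Prod.ext hpq (hιi ?_))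
      rw [← p.2.2, ← q.2.2]
      exact congrArg (g j) hpq
    · let φ : E j → D := fun p => ⟨(f p.1.1, p.1.2), p.2.1⟩
      obtain ⟨d, hd, hlim⟩ := (isProperMap_iff_ultrafilter.1 hDprop).2 (𝒰 := 𝒰.map φ) (y := f x)
        (((hf.continuous.tendsto x).comp hx :))
      have hlim' : Tendsto (fun p : E j => p.1) 𝒰 (𝓝 (x, d.1.2)) := by
        refine Tendsto.prodMk_nhds hx ?_
        have h1 : Tendsto φ 𝒰 (𝓝 d) := hlim
        exact ((continuous_snd.comp continuous_subtype_val).tendsto d).comp h1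
      have hmem := (hE j).mem_of_tendsto hlim' (Eventually.of_forall fun p => p.2)
      exact ⟨⟨_, hmem⟩, rfl, tendsto_subtype_rng.2 hlim'⟩
  have hSE : ∀ j, S (E j) := by
    intro j
    have hq : IsProperMap fun p : E j => (f p.1.1, p.1.2) :=
      (hf.prodMap isProperMap_id).comp (hE j).isClosedEmbedding_subtypeVal.isProperMap
    refine hS.of_isClosedMap hq.continuous hq.isClosedMap
      (hdim _ (range_subset_iff.2 fun p => p.2.1)) fun p => ?_
    let i : (fun p : E j => (f p.1.1, p.1.2)) ⁻¹' {(f p.1.1, p.1.2)} → f ⁻¹' {f p.1.1} :=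
      fun q => ⟨q.1.1.1, (Prod.ext_iff.1 q.2).1⟩
    refine hS.of_isClosedEmbedding (i := i)
      (.of_comp (g := Subtype.val) .subtypeVal ?_) (hfib (f p.1.1))
    exact (hemb j).comp (isClosed_singleton.preimage hq.continuous).isClosedEmbedding_subtypeVal
  refine ⟨fun j => range fun p : E j => p.1.1, fun j => (hemb j).isClosed_range, fun j =>
    hS.homeo (E j) _ (hemb j).isEmbedding.toHomeomorph (hSE j), fun y => ?_⟩
  obtain ⟨a, ha⟩ := hDsurj y
  -- One address of `y` suffices: a fibre point at level `ι a` of `g j` lies in the `j`-th removed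
  -- set.
  refine hgdim _ (ι a) (hιI a) fun j x hx hgx => hx.2 (mem_iUnion.2 ⟨j, ?_⟩)
  have hfx : f x = y := hx.1
  exact ⟨⟨(x, a), by rw [← hfx] at ha; exact ⟨ha, hgx⟩⟩, rfl⟩

/-! ### Closed maps -/

/-- Vainstein's lemma. -/
theorem IsClosedMap.isCompact_frontier_preimage_singleton {X Y : Type*} [TopologicalSpace X]
    [TopologicalSpace Y] [TopologicalSpace.MetrizableSpace X]
    [TopologicalSpace.MetrizableSpace Y] {f : X → Y} (hf : IsClosedMap f) (hfc : Continuous f)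
    (y : Y) : IsCompact (frontier (f ⁻¹' {y})) := by
  let _ := TopologicalSpace.metrizableSpaceMetric X
  let _ := TopologicalSpace.metrizableSpaceMetric Y
  have hpos : ∀ n : ℕ, (0 : ℝ) < 1 / (n + 1) := fun n => Nat.one_div_pos_of_nat
  have hlim0 := tendsto_one_div_add_atTop_nhds_zero_nat (𝕜 := ℝ)
  have hcl : IsClosed (f ⁻¹' {y}) := isClosed_singleton.preimage hfc
  refine isCompact_iff_isSeqCompact.2 fun x hx => ?_
  have hx' : ∀ n : ℕ, ∃ z, f z ≠ y ∧ dist z (x n) < 1 / (n + 1) ∧ dist (f z) y < 1 / (n + 1) := by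
    intro n
    have hxn : f (x n) = y := hcl.frontier_subset (hx n)
    have h1 : x n ∈ closure (f ⁻¹' {y})ᶜ := (frontier_eq_closure_inter_closure.le (hx n)).2
    have h2 : ∀ᶠ z in 𝓝 (x n), dist z (x n) < 1 / (n + 1) ∧ dist (f z) y < 1 / (n + 1) :=
      (Metric.eventually_nhds_iff_ball.2 ⟨_, hpos n, fun _ h => h⟩).and
        (hfc.continuousAt (by rw [hxn]; exact Metric.ball_mem_nhds _ (hpos n)))
    obtain ⟨z, hz, hz'⟩ := ((mem_closure_iff_frequently.1 h1).and_eventually h2).exists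
    exact ⟨z, hz, hz'⟩
  choose z hzy hzx hzf using hx'
  have hfz : Tendsto (f ∘ z) atTop (𝓝 y) :=
    tendsto_iff_dist_tendsto_zero.2
      (squeeze_zero (fun _ => dist_nonneg) (fun n => (hzf n).le) hlim0)
  -- Otherwise `range z` is closed, so its image is closed and contains the limit y, though f(z n) ≠
  -- y for all n.
  have hcluster : ∃ p, MapClusterPt p atTop z := by
    by_contra! hno
    have hC : IsClosed (range z) := by
      refine isClosed_iff_clusterPt.2 fun p hp => ?_
      have := hno p
      rw [mapClusterPt_iff_frequently] at this
      push Not at this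
      obtain ⟨s, hs, hsz⟩ := this
      obtain ⟨n, hn⟩ := eventually_atTop.1 hsz
      have hfin : (z '' Iio n).Finite := (finite_Iio n).image z
      have : p ∈ closure (z '' Iio n) := by
        refine mem_closure_iff_nhds.2 fun t ht => ?_
        obtain ⟨_, hw, k, rfl⟩ := clusterPt_principal_iff.1 hp _ (inter_mem ht hs)
        exact ⟨z k, hw.1, k, not_le.1 fun hk => hn k hk hw.2, rfl⟩
      exact image_subset_range _ _ (hfin.isClosed.closure_subset this)
    obtain ⟨_, ⟨n, rfl⟩, h⟩ := (hf _ hC).mem_of_tendsto hfz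
      (Eventually.of_forall fun n => mem_image_of_mem f (mem_range_self n))
    exact hzy n h
  obtain ⟨p, hp⟩ := hcluster
  obtain ⟨φ, hφ, hzφ⟩ := hp.tendsto_subseq
  have hxφ : Tendsto (x ∘ φ) atTop (𝓝 p) := by
    refine (tendsto_iff_of_dist ?_).1 hzφ
    exact squeeze_zero (fun _ => dist_nonneg) (fun n => (hzx (φ n)).le)
      (hlim0.comp hφ.tendsto_atTop)
  exact ⟨p, isClosed_frontier.mem_of_tendsto hxφ (Eventually.of_forall fun n => hx _), φ, hφ, hxφ⟩

/-- Preimages of arbitrary sets are clopen, so closedness of `q` makes every subset of the range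
closed: the range is discrete. -/
theorem IsWeakSProperty.of_locallyConstant (hS : IsWeakSProperty S) {E : Type u} {Y : Type v}
    [TopologicalSpace E] [TopologicalSpace Y] [TopologicalSpace.MetrizableSpace E]
    [TopologicalSpace.MetrizableSpace Y] {q : E → Y} (hq : IsLocallyConstant q)
    (hqc : IsClosedMap q) (hfib : ∀ x, S (q ⁻¹' {q x})) : S E := by
  have : DiscreteTopology (range q) := by
    refine discreteTopology_iff_forall_isClosed.2 fun s => ?_
    have h : Subtype.val '' s = q '' (q ⁻¹' (Subtype.val '' s)) :=
      (image_preimage_eq_of_subset (by rintro _ ⟨y, -, rfl⟩; exact y.2)).symm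
    rw [← preimage_image_eq s Subtype.val_injective, h]
    exact (hqc _ ⟨by rw [← preimage_compl]; exact hq _⟩).preimage continuous_subtype_val
  exact hS.of_isClosedMap hq.continuous hqc (coveringDimLE_zero_of_discreteTopology _) hfib

theorem IsWeakSProperty.exists_isFSigmaSet (hS : IsWeakSProperty S) {X : Type u}
    {Y : Type v} [TopologicalSpace X] [TopologicalSpace Y] [TopologicalSpace.MetrizableSpace X]
    [TopologicalSpace.MetrizableSpace Y] {f : X → Y} (hcont : Continuous f)
    (hclosed : IsClosedMap f) (hfib : ∀ y, S (f ⁻¹' {y})) :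
    ∃ A : Set X, IsFSigmaSet A ∧ S A ∧ ∀ y, CoveringDimLE (f ⁻¹' {y} \ A : Set X) 0 := by
  let _ := TopologicalSpace.metrizableSpaceMetric X
  let O : Set X := ⋃ y, interior (f ⁻¹' {y})
  have hO : IsOpen O := isOpen_iUnion fun _ => isOpen_interior
  have hOmem : ∀ x ∈ O, x ∈ interior (f ⁻¹' {f x}) := by
    intro x hx
    obtain ⟨y, hy⟩ := mem_iUnion.1 hx
    have hxy : x ∈ f ⁻¹' {y} := interior_subset hy
    rwa [show f x = y from hxy]
  have hcl : ∀ y, IsClosed (f ⁻¹' {y}) := fun y => isClosed_singleton.preimage hcont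
  have hSsub : ∀ {B : Set X}, IsClosed B → ∀ y, S ((fun x : B => f x) ⁻¹' {y}) := by
    intro B hB y
    refine hS.of_isClosedEmbedding (i := fun p => (⟨p.1.1, p.2⟩ : f ⁻¹' {y}))
      (.of_comp (g := Subtype.val) .subtypeVal ?_) (hfib y)
    exact hB.isClosedEmbedding_subtypeVal.comp
      (isClosed_singleton.preimage
        (hcont.comp continuous_subtype_val)).isClosedEmbedding_subtypeVal
  have hproper : IsProperMap fun x : (Oᶜ : Set X) => f x := by
    have he := hO.isClosed_compl.isClosedEmbedding_subtypeVal
    refine isProperMap_iff_isClosedMap_and_compact_fibers.2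
      ⟨by fun_prop, hclosed.comp he.isClosedMap, fun y => ?_⟩
    refine (he.isCompact_preimage
      (hclosed.isCompact_frontier_preimage_singleton hcont y)).of_isClosed_subset
      ((hcl y).preimage continuous_subtype_val) fun x hx => ?_
    -- Outside `O` a fibre has lost its interior, leaving only part of its compact frontier.
    rw [mem_preimage, (hcl y).frontier_eq]
    exact ⟨hx, fun h => x.2 (mem_iUnion.2 ⟨y, h⟩)⟩
  obtain ⟨Z, hZ, hZS, hZdim⟩ :=
    hS.exists_isClosed_of_isProperMap hproper (hSsub hO.isClosed_compl)
  have he := hO.isClosed_compl.isClosedEmbedding_subtypeVal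
  obtain ⟨H, hH, hHO, hHU, -⟩ := hO.exists_iUnion_isClosed
  have hSH : ∀ n, S (H n) := by
    intro n
    refine hS.of_locallyConstant (q := fun x : H n => f x) ?_
      (hclosed.comp (hH n).isClosedEmbedding_subtypeVal.isClosedMap) fun x => hSsub (hH n) _
    refine (IsLocallyConstant.iff_eventually_eq _).2 fun x => ?_
    filter_upwards [continuous_subtype_val.continuousAt
      (isOpen_interior.mem_nhds (hOmem x (hHO n x.2)))] with y hy
    have hxy : y.1 ∈ f ⁻¹' {f x} := interior_subset hy
    exact hxy
  let G : ℕ → Set X := fun n =>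
    if Even n then Subtype.val '' Z (n / 2) else H (n / 2)
  have hG0 : ∀ n, G (2 * n) = Subtype.val '' Z n := fun n => by simp [G]
  have hG1 : ∀ n, G (2 * n + 1) = H n := fun n => by
    simp [G, show (2 * n + 1) / 2 = n by omega]
  have hall : ∀ {P : Set X → Prop}, (∀ n, P (Subtype.val '' Z n)) → (∀ n, P (H n)) →
      ∀ n, P (G n) := by
    intro P h0 h1 n
    by_cases h : Even n
    · simp only [G, h, if_true, h0]
    · simp only [G, h, if_false, h1]
  have hGcl : ∀ n, IsClosed (G n) := hall (fun n => he.isClosedMap _ (hZ n)) hH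
  have hGS : ∀ n, S (G n) := hall (P := fun B => S B)
    (fun n => hS.homeo (Z n) _
      (he.isEmbedding.homeomorphImage (Z n)) (hZS n)) hSH
  refine ⟨⋃ n, G n, ⟨G, hGcl, rfl⟩, hS.countable_union X G hGcl hGS, fun y => ?_⟩
  have himage : Subtype.val '' ((fun x : (Oᶜ : Set X) => f x) ⁻¹' {y} \ ⋃ j, Z j) =
      f ⁻¹' {y} \ ⋃ n, G n := by
    ext x
    constructor
    · rintro ⟨x, hx, rfl⟩
      refine ⟨hx.1, fun h => ?_⟩
      obtain ⟨n, hn⟩ := mem_iUnion.1 h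
      revert hn
      refine hall (P := fun B => x.1 ∉ B) (fun n hn => ?_) (fun n hn => x.2 (hHO n hn)) n
      obtain ⟨x', hx', h⟩ := hn
      rw [Subtype.val_injective h] at hx'
      exact hx.2 (mem_iUnion.2 ⟨n, hx'⟩)
    · rintro ⟨hx, hxG⟩
      have hxO : x ∉ O := by
        rw [← hHU]
        intro h
        obtain ⟨n, hn⟩ := mem_iUnion.1 h
        exact hxG (mem_iUnion.2 ⟨2 * n + 1, by rwa [hG1]⟩)
      refine ⟨⟨x, hxO⟩, ⟨hx, fun h => ?_⟩, rfl⟩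
      obtain ⟨n, hn⟩ := mem_iUnion.1 h
      exact hxG (mem_iUnion.2 ⟨2 * n, by rw [hG0]; exact ⟨_, hn, rfl⟩⟩)
  rw [← himage]
  exact (hZdim y).of_homeomorph (he.isEmbedding.homeomorphImage _)

theorem theorem1p1 (S : (M : Type u) → [TopologicalSpace M] → Prop)
    {X : Type u} {Y : Type v} [TopologicalSpace X] [TopologicalSpace Y]
    [TopologicalSpace.MetrizableSpace X] [TopologicalSpace.MetrizableSpace Y]
    (f : X → Y) (hcont : Continuous f) (hclosed : IsClosedMap f)
    (hsurj : Function.Surjective f) (hfib : ∀ y, S (f ⁻¹' {y})) :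
    (IsSProperty S →
      ∃ A : Set X, IsFSigmaSet A ∧ S A ∧ ∀ y, CoveringDimLE (f ⁻¹' {y} \ A : Set X) 0) ∧
    (IsProperMap f → IsWeakSProperty S →
      ∃ A : Set X, IsFSigmaSet A ∧ S A ∧ ∀ y, CoveringDimLE (f ⁻¹' {y} \ A : Set X) 0) :=
  ⟨fun hS => hS.toIsWeakSProperty.exists_isFSigmaSet hcont hclosed hfib,
    fun _ hS => hS.exists_isFSigmaSet hcont hclosed hfib⟩
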